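/- Work with structures $\mathcal M=(M,\in^{\mathcal M})$ for the first-order language $\mathcal L_\in=\{\in,=\}$ of set theory. $\mathsf{DB}_0$ is the theory with axioms extensionality, null set, pairing, union, cartesian product and $\Delta_0$ separation (no foundation and no infinity); $\mathsf{TCo}$ says that every set is an element of some transitive set. $\mathsf{Coll}(\Sigma_m)$ is the schema $$\forall v\,\forall p\,\bigl(\forall x\in p\,\exists y\,\varphi(x,y,v)\to\exists q\,\forall x\in p\,\exists y\in q\,\varphi(x,y,v)\bigr)$$ for all $\Sigma_m$ formulas $\varphi$ of the Lévy hierarchy, and $\mathsf{Coll}$ is the same schema for all $\mathcal L_\in$-formulas $\varphi$. An extension $\mathcal N\supseteq\mathcal M$ is an end extension if $\mathcal N\models b\in a$ with $a\in M$, $b\in N$ implies $b\in M$. It is taller* if there is $c\in N$ such that $\mathcal N\models$ "$c$ is a transitive set" and $\mathcal N\models a\in c$ for every $a\in M$. It is $\Sigma_m$-elementary if every $\Sigma_m$ formula with parameters from $M$ holds in $\mathcal M$ if and only if it holds in $\mathcal N$. **Theorem.** Let $\mathcal M$ be a countable model of $\mathsf{DB}_0+\mathsf{TCo}$. 1. For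 every natural number $n\ge 0$, if $\mathcal M\models\mathsf{Coll}(\Sigma_{n+2})$, then $\mathcal M$ has a $\Sigma_{n+2}$-elementary taller* end extension. 2. If $\mathcal M\models\mathsf{Coll}$, then $\mathcal M$ has a (fully) elementary taller* end extension. -/

import Mathlib

open FirstOrder FirstOrder.Language

universe u v

namespace LevySet

/-- The only non-logical symbol of the language of set theory: binary membership. -/
inductive MemRel : ℕ → Type
  | mem : MemRel 2

/-- The first-order language of set theory (equality is logical). -/
def LSet : FirstOrder.Language.{0, 0} := ⟨fun _ => Empty, MemRel⟩

/-- The membership symbol. -/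
def memSym : LSet.Relations 2 := MemRel.mem

instance (n : ℕ) : IsEmpty (LSet.Functions n) := inferInstanceAs (IsEmpty Empty)

/-- The atomic formula saying that the variable `a` is a member of the variable `b`. -/
def memFormula {α : Type} {n : ℕ} (a b : α ⊕ Fin n) : LSet.BoundedFormula α n :=
  memSym.boundedFormula₂ (Term.var a) (Term.var b)

/-- The atomic formula `x ∈ b`, where `x` is the last (about to be quantified) variable and `b` is
one of the other variables. -/
def lastMem {α : Type} {n : ℕ} (b : α ⊕ Fin n) : LSet.BoundedFormula α (n + 1) :=
  memFormula (Sum.inr (Fin.last n)) (Sum.map id Fin.castSucc b)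

/-- `Δ₀` formulas: built from atomic formulas by propositional connectives and the bounded
quantifiers `∀ x ∈ b` and `∃ x ∈ b`. -/
inductive IsDelta0 {α : Type} : ∀ {n : ℕ}, LSet.BoundedFormula α n → Prop
  | falsum {n : ℕ} : IsDelta0 (⊥ : LSet.BoundedFormula α n)
  | atomic {n : ℕ} {φ : LSet.BoundedFormula α n} (h : φ.IsAtomic) : IsDelta0 φ
  | imp {n : ℕ} {φ ψ : LSet.BoundedFormula α n} (hφ : IsDelta0 φ) (hψ : IsDelta0 ψ) :
      IsDelta0 (φ.imp ψ)
  | ball {n : ℕ} (b : α ⊕ Fin n) {φ : LSet.BoundedFormula α (n + 1)} (hφ : IsDelta0 φ) :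
      IsDelta0 ((lastMem b).imp φ).all
  | bex {n : ℕ} (b : α ⊕ Fin n) {φ : LSet.BoundedFormula α (n + 1)} (hφ : IsDelta0 φ) :
      IsDelta0 (lastMem b ⊓ φ).ex

/-- The Lévy hierarchy: `IsLevy true k` is the class `Σ_k` and `IsLevy false k` the class `Π_k`.
`Σ_0 = Π_0 = Δ₀`; a `Σ_{k+1}` formula is a (possibly empty) block of existential quantifiers
followed by a `Π_k` formula, and dually for `Π_{k+1}`. -/
inductive IsLevy {α : Type} : Bool → ℕ → ∀ {n : ℕ}, LSet.BoundedFormula α n → Prop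
  | delta0 {b : Bool} {n : ℕ} {φ : LSet.BoundedFormula α n} (h : IsDelta0 φ) : IsLevy b 0 φ
  | of_pi {k n : ℕ} {φ : LSet.BoundedFormula α n} (h : IsLevy false k φ) : IsLevy true (k + 1) φ
  | ex {k n : ℕ} {φ : LSet.BoundedFormula α (n + 1)} (h : IsLevy true (k + 1) φ) :
      IsLevy true (k + 1) φ.ex
  | of_sigma {k n : ℕ} {φ : LSet.BoundedFormula α n} (h : IsLevy true k φ) :
      IsLevy false (k + 1) φ
  | all {k n : ℕ} {φ : LSet.BoundedFormula α (n + 1)} (h : IsLevy false (k + 1) φ) :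
      IsLevy false (k + 1) φ.all

/-- `φ` is a `Σ_k` formula. -/
abbrev IsSigma {α : Type} (k : ℕ) {n : ℕ} (φ : LSet.BoundedFormula α n) : Prop := IsLevy true k φ

/-- `φ` is a `Π_k` formula. -/
abbrev IsPi {α : Type} (k : ℕ) {n : ℕ} (φ : LSet.BoundedFormula α n) : Prop := IsLevy false k φ

section Axioms

/-- `Mem x y`: the structure satisfies `x ∈ y`. -/
def Mem {M : Type u} [LSet.Structure M] (x y : M) : Prop :=
  Structure.RelMap memSym ![x, y]

/-- In the structure, `z = {x, y}`. -/
def IsUPair {M : Type u} [LSet.Structure M] (z x y : M) : Prop :=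
  ∀ w : M, Mem w z ↔ w = x ∨ w = y

/-- In the structure, `z` is the Kuratowski pair `(x, y) = {{x}, {x, y}}`. -/
def IsOPair {M : Type u} [LSet.Structure M] (z x y : M) : Prop :=
  ∀ w : M, Mem w z ↔ IsUPair w x x ∨ IsUPair w x y

/-- In the structure, `t` is a transitive set. -/
def IsTrans {M : Type u} [LSet.Structure M] (t : M) : Prop :=
  ∀ x y : M, Mem x t → Mem y x → Mem y t

/-- `M` satisfies `Sep(φ)`, for a formula `φ(x, v)` with a tuple `v` of parameters. -/
def SatSep (M : Type u) [LSet.Structure M] {k : ℕ} (φ : LSet.BoundedFormula (Fin k) 1) : Prop :=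
  ∀ (v : Fin k → M) (p : M), ∃ q : M, ∀ x : M, Mem x q ↔ Mem x p ∧ φ.Realize v ![x]

/-- `M` satisfies `Coll(φ)`, for a formula `φ(x, y, v)` with a tuple `v` of parameters. -/
def SatColl (M : Type u) [LSet.Structure M] {k : ℕ} (φ : LSet.BoundedFormula (Fin k) 2) : Prop :=
  ∀ (v : Fin k → M) (p : M), (∀ x : M, Mem x p → ∃ y : M, φ.Realize v ![x, y]) →
    ∃ q : M, ∀ x : M, Mem x p → ∃ y : M, Mem y q ∧ φ.Realize v ![x, y]

/-- `M` is a model of `DB₀`: extensionality, null set, pairing, union, cartesian product and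
`Δ₀` separation. -/
structure ModelsDB0 (M : Type u) [LSet.Structure M] : Prop where
  extensionality : ∀ x y : M, (∀ z : M, Mem z x ↔ Mem z y) → x = y
  nullset : ∃ x : M, ∀ z : M, ¬ Mem z x
  pairing : ∀ x y : M, ∃ z : M, IsUPair z x y
  union : ∀ x : M, ∃ z : M, ∀ w : M, Mem w z ↔ ∃ y : M, Mem y x ∧ Mem w y
  product : ∀ a b : M, ∃ c : M, ∀ z : M,
    Mem z c ↔ ∃ x y : M, Mem x a ∧ Mem y b ∧ IsOPair z x y
  separation : ∀ (k : ℕ) (φ : LSet.BoundedFormula (Fin k) 1), IsDelta0 φ → SatSep M φ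

/-- `M` satisfies transitive containment: every set is an element of a transitive set. -/
def ModelsTCo (M : Type u) [LSet.Structure M] : Prop :=
  ∀ x : M, ∃ t : M, IsTrans t ∧ Mem x t

/-- `M` satisfies the schema `Coll(Σ_m)`. -/
def ModelsCollSigma (M : Type u) [LSet.Structure M] (m : ℕ) : Prop :=
  ∀ (k : ℕ) (φ : LSet.BoundedFormula (Fin k) 2), IsSigma m φ → SatColl M φ

/-- `M` satisfies the full collection schema `Coll`. -/
def ModelsColl (M : Type u) [LSet.Structure M] : Prop :=
  ∀ (k : ℕ) (φ : LSet.BoundedFormula (Fin k) 2), SatColl M φ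

end Axioms

section Extensions

/-- The map `j : M → N` is `Σ_m`-elementary: it preserves and reflects `Σ_m` formulas. -/
def IsSigmaElementary {M : Type u} {N : Type v} [LSet.Structure M] [LSet.Structure N]
    (m : ℕ) (j : M → N) : Prop :=
  ∀ (k : ℕ) (φ : LSet.Formula (Fin k)), IsSigma m φ →
    ∀ a : Fin k → M, φ.Realize (j ∘ a) ↔ φ.Realize a

/-- `N` is an end extension of (the image of) `M`: members of old elements are old. -/
def IsEndExtension {M : Type u} {N : Type v} [LSet.Structure N] (j : M → N) : Prop :=
  ∀ (a : M) (b : N), Mem b (j a) → ∃ a' : M, j a' = b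

/-- `N` is taller* than (the image of) `M`: some transitive set of `N` has every element of `M` as
a member. -/
def IsTallerStar {M : Type u} {N : Type v} [LSet.Structure N] (j : M → N) : Prop :=
  ∃ c : N, IsTrans c ∧ ∀ a : M, Mem (j a) c

end Extensions

end LevySet

/-!
The extension is a substructure of an ultrapower of `M`, generated by a forcing argument.

Points of the index set are assignments `s : ℕ → M`. A condition is a set `S` of assignments which
is definable with parameters, by a `Σ_{n+1}` formula about finitely many of the values `s i` (by an
arbitrary formula for the second claim), and which is *large*: for every `a ∈ M`, some `s ∈ S` has
a transitive set `s 0` with `a ∈ s 0`. By transitive containment there are large sets. A generic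
ultrafilter `G` is obtained by meeting countably many requirements
(`IsForcingClass.exists_isGeneric`), and the generic model consists of the coordinates `s ↦ s i`
modulo `G`.

* The coordinate `0` is a transitive set that contains all of `M`, because all conditions are large.
* Existential statements are witnessed: a large condition that implies `∃ y, ψ(y, s)` stays large
  when a coordinate it does not mention is required to be a witness
  (`IsForcingClass.exists_large_witness`). This gives the truth lemma for the formulas whose
  definable sets are conditions (`truth_of_isLevy`, `truth_of_univ`).
* Elements of old sets are old: if a large condition implies `s i ∈ a`, then it stays large after
  adding `s i = b` for some `b ∈ a` (`IsForcingClass.exists_large_coord_eq`). Otherwise each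
  `b ∈ a` would have a `y` such that no `s` in the condition has `s i = b` and `y ∈ s 0` transitive;
  this is a `Π_{n+1}` property of `b` and `y`, so collection bounds these `y` by a set `q`, and
  an assignment in the condition with `q ∈ s 0` is contradictory.

The truth lemma holds for `Σ_{n+1}` and `Π_{n+1}` formulas, so a `Σ_{n+2}` formula that holds in the
generic model holds almost everywhere in `M`, and a `Σ_{n+2}` formula that holds in `M` keeps its
witnesses (`IsLevy.eventually_realize`, `IsLevy.realize_coord`).
-/

namespace LevySet

/-! ### Renaming variables in formulas -/

section Renaming

variable {α β : Type} {M : Type u}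

/-- The extension of a renaming of variables to one more bound variable, which is kept fixed. -/
def liftRen {n m : ℕ} (g : α ⊕ Fin n → β ⊕ Fin m) : α ⊕ Fin (n + 1) → β ⊕ Fin (m + 1) :=
  Sum.elim (fun a => Sum.map id Fin.castSucc (g (Sum.inl a)))
    (Fin.lastCases (Sum.inr (Fin.last m)) fun i => Sum.map id Fin.castSucc (g (Sum.inr i)))

/-- Substitution of variables for variables. Unlike `BoundedFormula.relabel`, it may identify the
bound-variable slots `Fin n` with each other and with free variables. -/
def rename : ∀ {n m : ℕ}, (α ⊕ Fin n → β ⊕ Fin m) → LSet.BoundedFormula α n →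
    LSet.BoundedFormula β m
  | _, _, _, .falsum => .falsum
  | _, _, g, .equal t u => .equal (t.relabel g) (u.relabel g)
  | _, _, g, .rel R ts => .rel R fun i => (ts i).relabel g
  | _, _, g, .imp φ ψ => (rename g φ).imp (rename g ψ)
  | _, _, g, .all φ => (rename (liftRen g) φ).all

theorem elim_snoc_map_castSucc {n : ℕ} (v : α → M) (xs : Fin n → M) (a : M) (c : α ⊕ Fin n) :
    Sum.elim v (Fin.snoc xs a : Fin (n + 1) → M) (Sum.map id Fin.castSucc c) = Sum.elim v xs c := by
  cases c <;> simp

theorem elim_comp_liftRen {n m : ℕ} (g : α ⊕ Fin n → β ⊕ Fin m) (v : β → M) (xs : Fin m → M)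
    (a : M) :
    Sum.elim v (Fin.snoc xs a : Fin (m + 1) → M) ∘ liftRen g =
      Sum.elim (Sum.elim v xs ∘ g ∘ Sum.inl)
        (Fin.snoc (Sum.elim v xs ∘ g ∘ Sum.inr) a : Fin (n + 1) → M) := by
  funext c
  rcases c with c | c
  · simp [liftRen, elim_snoc_map_castSucc]
  · induction c using Fin.lastCases <;> simp [liftRen, elim_snoc_map_castSucc]

variable [LSet.Structure M]

theorem realize_rename {n m : ℕ} (g : α ⊕ Fin n → β ⊕ Fin m) (φ : LSet.BoundedFormula α n)
    (v : β → M) (xs : Fin m → M) :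
    (rename g φ).Realize v xs ↔
      φ.Realize (Sum.elim v xs ∘ g ∘ Sum.inl) (Sum.elim v xs ∘ g ∘ Sum.inr) := by
  have key : ∀ {n m : ℕ} (g : α ⊕ Fin n → β ⊕ Fin m) (v : β → M) (xs : Fin m → M),
      Sum.elim (Sum.elim v xs ∘ g ∘ Sum.inl) (Sum.elim v xs ∘ g ∘ Sum.inr) = Sum.elim v xs ∘ g := by
    intro n m g v xs
    funext c
    cases c <;> rfl
  induction φ generalizing m with
  | falsum => rfl
  | equal t u => simp [rename, BoundedFormula.Realize, key]
  | rel R ts => simp [rename, BoundedFormula.Realize, key]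
  | imp φ ψ ih₁ ih₂ => simp [rename, ih₁, ih₂]
  | all φ ih =>
    simp only [rename, BoundedFormula.realize_all]
    refine forall_congr' fun a => ?_
    refine (ih _ _).trans ?_
    rw [← Function.comp_assoc, ← Function.comp_assoc, elim_comp_liftRen, Sum.elim_comp_inl,
      Sum.elim_comp_inr]

theorem rename_lastMem {n m : ℕ} (g : α ⊕ Fin n → β ⊕ Fin m) (b : α ⊕ Fin n) :
    rename (liftRen g) (lastMem b) = lastMem (g b) := by
  have h : liftRen g (Sum.map id Fin.castSucc b) = Sum.map id Fin.castSucc (g b) := by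
    cases b <;> simp [liftRen]
  have h' : liftRen g (Sum.inr (Fin.last n)) = Sum.inr (Fin.last m) := by simp [liftRen]
  simp only [lastMem, memFormula, Relations.boundedFormula₂, Relations.boundedFormula, rename]
  congr 1
  funext i
  fin_cases i <;> simp [h, h']

theorem IsDelta0.rename {n m : ℕ} {φ : LSet.BoundedFormula α n} (h : IsDelta0 φ)
    (g : α ⊕ Fin n → β ⊕ Fin m) : IsDelta0 (rename g φ) := by
  induction h generalizing m with
  | falsum => exact .falsum
  | atomic h => cases h with
    | equal => exact .atomic (.equal _ _)
    | rel => exact .atomic (.rel _ _)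
  | imp _ _ ih₁ ih₂ => exact .imp (ih₁ g) (ih₂ g)
  | ball b _ ih =>
    have := IsDelta0.ball (g b) (ih (liftRen g))
    rwa [← rename_lastMem] at this
  | bex b _ ih =>
    have := IsDelta0.bex (g b) (ih (liftRen g))
    rwa [← rename_lastMem] at this

theorem IsLevy.rename {b : Bool} {k n m : ℕ} {φ : LSet.BoundedFormula α n} (h : IsLevy b k φ)
    (g : α ⊕ Fin n → β ⊕ Fin m) : IsLevy b k (rename g φ) := by
  induction h generalizing m with
  | delta0 h => exact .delta0 (h.rename g)
  | of_pi _ ih => exact .of_pi (ih g)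
  | of_sigma _ ih => exact .of_sigma (ih g)
  | ex _ ih => exact .ex (ih (liftRen g))
  | all _ ih => exact .all (ih (liftRen g))

end Renaming

/-! ### Closure properties of the Lévy hierarchy -/

section Levy

variable {α β : Type} {M : Type u} [LSet.Structure M]

theorem realize_memFormula {n : ℕ} (a b : α ⊕ Fin n) (v : α → M) (xs : Fin n → M) :
    (memFormula a b).Realize v xs ↔ Mem (Sum.elim v xs a) (Sum.elim v xs b) := by
  simp [memFormula, Mem, BoundedFormula.realize_rel₂]

theorem realize_lastMem {n : ℕ} (b : α ⊕ Fin n) (v : α → M) (xs : Fin n → M) (a : M) :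
    (lastMem b).Realize v (Fin.snoc xs a : Fin (n + 1) → M) ↔ Mem a (Sum.elim v xs b) := by
  simp [lastMem, realize_memFormula, elim_snoc_map_castSucc]

theorem isDelta0_memFormula {n : ℕ} (a b : α ⊕ Fin n) : IsDelta0 (memFormula a b) :=
  .atomic (.rel _ _)

theorem IsDelta0.not {n : ℕ} {φ : LSet.BoundedFormula α n} (h : IsDelta0 φ) : IsDelta0 φ.not :=
  .imp h .falsum

theorem IsDelta0.inf {n : ℕ} {φ ψ : LSet.BoundedFormula α n} (hφ : IsDelta0 φ) (hψ : IsDelta0 ψ) :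
    IsDelta0 (φ ⊓ ψ) :=
  (hφ.imp hψ.not).not

theorem IsLevy.succ {b : Bool} {k n : ℕ} {φ : LSet.BoundedFormula α n} (h : IsLevy b k φ) :
    IsLevy b (k + 1) φ := by
  induction h with
  | @delta0 b _ _ h => cases b with
    | true => exact .of_pi (.delta0 h)
    | false => exact .of_sigma (.delta0 h)
  | of_pi _ ih => exact .of_pi ih
  | of_sigma _ ih => exact .of_sigma ih
  | ex _ ih => exact .ex ih
  | all _ ih => exact .all ih

theorem IsLevy.mono {b : Bool} {k l n : ℕ} {φ : LSet.BoundedFormula α n} (h : IsLevy b k φ)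
    (hkl : k ≤ l) : IsLevy b l φ := by
  induction hkl with
  | refl => exact h
  | step _ ih => exact ih.succ

/-- The negation of a `Σ_k` formula is equivalent to a `Π_k` formula, and conversely. -/
theorem IsLevy.exists_not {b : Bool} {k n : ℕ} {φ : LSet.BoundedFormula α n} (h : IsLevy b k φ) :
    ∃ χ : LSet.BoundedFormula α n, IsLevy (!b) k χ ∧
      ∀ (v : α → M) (xs : Fin n → M), χ.Realize v xs ↔ ¬ φ.Realize v xs := by
  induction h with
  | delta0 h => exact ⟨_, .delta0 h.not, fun _ _ => Iff.rfl⟩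
  | of_pi _ ih => obtain ⟨χ, h, hχ⟩ := ih; exact ⟨χ, .of_sigma h, hχ⟩
  | of_sigma _ ih => obtain ⟨χ, h, hχ⟩ := ih; exact ⟨χ, .of_pi h, hχ⟩
  | ex _ ih => obtain ⟨χ, h, hχ⟩ := ih; exact ⟨χ.all, .all h, fun v xs => by simp [hχ]⟩
  | all _ ih => obtain ⟨χ, h, hχ⟩ := ih; exact ⟨χ.ex, .ex h, fun v xs => by simp [hχ]⟩

/-- The weakening of a formula by one unused bound variable. -/
abbrev weaken {n : ℕ} (φ : LSet.BoundedFormula α n) : LSet.BoundedFormula α (n + 1) :=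
  rename (Sum.map id Fin.castSucc) φ

theorem realize_weaken {n : ℕ} (φ : LSet.BoundedFormula α n) (v : α → M) (xs : Fin n → M) (a : M) :
    (weaken φ).Realize v (Fin.snoc xs a : Fin (n + 1) → M) ↔ φ.Realize v xs := by
  rw [realize_rename]
  have h₁ : Sum.elim v (Fin.snoc xs a : Fin (n + 1) → M) ∘ Sum.map id Fin.castSucc ∘ Sum.inl
      = v := by funext; simp
  have h₂ : Sum.elim v (Fin.snoc xs a : Fin (n + 1) → M) ∘ Sum.map id Fin.castSucc ∘ Sum.inr
      = xs := by funext; simp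
  rw [h₁, h₂]

variable [Nonempty M]

/-- `Σ_k` and `Π_k` are closed under conjunction up to equivalence: the quantifiers of both
conjuncts are pulled to the front, block by block. The renaming `g` of the first conjunct lets the
induction move it under the quantifiers of the second one. -/
theorem IsLevy.exists_rename_inf {b : Bool} {k n : ℕ} {φ : LSet.BoundedFormula α n}
    (h : IsLevy b k φ) {m : ℕ} (g : α ⊕ Fin n → β ⊕ Fin m) {ψ : LSet.BoundedFormula β m}
    (hψ : IsLevy b k ψ) :
    ∃ χ : LSet.BoundedFormula β m, IsLevy b k χ ∧
      ∀ (v : β → M) (xs : Fin m → M),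
        χ.Realize v xs ↔ (LevySet.rename g φ).Realize v xs ∧ ψ.Realize v xs := by
  induction h generalizing m with
  | delta0 h =>
    cases hψ with
    | delta0 hψ => exact ⟨_, .delta0 ((h.rename g).inf hψ), fun _ _ => BoundedFormula.realize_inf⟩
  | @of_pi k n φ h ih =>
    generalize hb : true = b at hψ
    generalize hl : k + 1 = l at hψ
    induction hψ with
    | delta0 => cases hl
    | of_sigma => cases hb
    | all => cases hb
    | of_pi hψ _ =>
      cases hl
      obtain ⟨χ, h, hχ⟩ := ih g hψ
      exact ⟨χ, .of_pi h, hχ⟩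
    | ex _ ih' =>
      cases hl
      obtain ⟨χ, h, hχ⟩ := ih' (Sum.map id Fin.castSucc ∘ g) rfl rfl
      refine ⟨χ.ex, .ex h, fun v xs => ?_⟩
      simp only [BoundedFormula.realize_ex, hχ, realize_rename]
      have : ∀ a, Sum.elim v (Fin.snoc xs a : Fin (_ + 1) → M) ∘ Sum.map id Fin.castSucc =
          Sum.elim v xs := fun a => funext fun c => elim_snoc_map_castSucc v xs a c
      simp only [← Function.comp_assoc, this, exists_and_left]
  | @of_sigma k n φ h ih =>
    generalize hb : false = b at hψ
    generalize hl : k + 1 = l at hψ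
    induction hψ with
    | delta0 => cases hl
    | of_pi => cases hb
    | ex => cases hb
    | of_sigma hψ _ =>
      cases hl
      obtain ⟨χ, h, hχ⟩ := ih g hψ
      exact ⟨χ, .of_sigma h, hχ⟩
    | all _ ih' =>
      cases hl
      obtain ⟨χ, h, hχ⟩ := ih' (Sum.map id Fin.castSucc ∘ g) rfl rfl
      refine ⟨χ.all, .all h, fun v xs => ?_⟩
      simp only [BoundedFormula.realize_all, hχ, realize_rename]
      have : ∀ a, Sum.elim v (Fin.snoc xs a : Fin (_ + 1) → M) ∘ Sum.map id Fin.castSucc =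
          Sum.elim v xs := fun a => funext fun c => elim_snoc_map_castSucc v xs a c
      simp only [← Function.comp_assoc, this, forall_and, forall_const]
  | ex _ ih =>
    obtain ⟨χ, h, hχ⟩ := ih (liftRen g) (hψ.rename (Sum.map id Fin.castSucc))
    refine ⟨χ.ex, .ex h, fun v xs => ?_⟩
    simp only [BoundedFormula.realize_ex, hχ, realize_weaken, exists_and_right]
    exact and_congr_left fun _ => BoundedFormula.realize_ex.symm
  | all _ ih =>
    obtain ⟨χ, h, hχ⟩ := ih (liftRen g) (hψ.rename (Sum.map id Fin.castSucc))
    refine ⟨χ.all, .all h, fun v xs => ?_⟩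
    simp only [BoundedFormula.realize_all, hχ, realize_weaken, forall_and, forall_const]
    exact and_congr_left fun _ => Iff.rfl

theorem IsLevy.exists_inf {b : Bool} {k n : ℕ} {φ ψ : LSet.BoundedFormula α n}
    (hφ : IsLevy b k φ) (hψ : IsLevy b k ψ) :
    ∃ χ : LSet.BoundedFormula α n, IsLevy b k χ ∧
      ∀ (v : α → M) (xs : Fin n → M), χ.Realize v xs ↔ φ.Realize v xs ∧ ψ.Realize v xs := by
  obtain ⟨χ, h, hχ⟩ := hφ.exists_rename_inf (M := M) id hψ
  exact ⟨χ, h, fun v xs => by simp [hχ, realize_rename]⟩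

theorem IsLevy.alls {k n : ℕ} {φ : LSet.BoundedFormula α n} (h : IsLevy false (k + 1) φ) :
    IsLevy false (k + 1) φ.alls := by
  induction n with
  | zero => exact h
  | succ n ih => exact ih h.all

end Levy

/-! ### Generic ultrafilters on the space of assignments -/

section Forcing

variable {M : Type u}

/-- The assignment `y, s 0, s 1, …`. -/
def cons (y : M) (s : ℕ → M) : ℕ → M
  | 0 => y
  | i + 1 => s i

variable [LSet.Structure M]

/-- A countable class of sets of assignments `ℕ → M` that may serve as forcing conditions. The last
field is collection for the predicate "no assignment `x, y, s 0, s 1, …` is in `S`". -/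
structure IsForcingClass (D : Set (Set (ℕ → M))) : Prop where
  countable : D.Countable
  inter : ∀ S ∈ D, ∀ T ∈ D, S ∩ T ∈ D
  reindex : ∀ S ∈ D, ∀ f : ℕ → ℕ, {s | s ∘ f ∈ S} ∈ D
  coord_eq : ∀ i j : ℕ, {s | s i = s j} ∈ D
  coord_eq_const : ∀ (i : ℕ) (b : M), {s | s i = b} ∈ D
  coord_mem : ∀ i j : ℕ, {s | Mem (s i) (s j)} ∈ D
  coord_trans : ∀ i : ℕ, {s | IsTrans (s i)} ∈ D
  support : ∀ S ∈ D, ∃ m : ℕ, ∀ s s' : ℕ → M, (∀ i < m, s i = s' i) → s ∈ S → s' ∈ S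
  coll : ∀ S ∈ D, ∀ a : M,
    (∀ x, Mem x a → ∃ y, ∀ s, cons x (cons y s) ∉ S) →
      ∃ q, ∀ x, Mem x a → ∃ y, Mem y q ∧ ∀ s, cons x (cons y s) ∉ S

/-- A set of assignments is large if its members assign to the variable `0` transitive sets that
contain any given element of `M`. -/
def Large (S : Set (ℕ → M)) : Prop :=
  ∀ a : M, ∃ s ∈ S, IsTrans (s 0) ∧ Mem a (s 0)

/-- Genericity of an ultrafilter on the space of assignments, relative to a class `D` of sets. In
the structure of coordinate functions modulo the ultrafilter, `tall` makes the coordinate `0`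
a transitive set containing all of `M`, `bounded` gives an end extension and `witness` gives the
existential case of the truth lemma. -/
structure IsGeneric (D : Set (Set (ℕ → M))) (G : Ultrafilter (ℕ → M)) : Prop where
  tall : ∀ a : M, ∀ᶠ s : ℕ → M in G, IsTrans (s 0) ∧ Mem a (s 0)
  bounded : ∀ (i : ℕ) (a : M), (∀ᶠ s : ℕ → M in G, Mem (s i) a) →
    ∃ b : M, ∀ᶠ s : ℕ → M in G, s i = b
  witness : ∀ T ∈ D, (∀ᶠ s : ℕ → M in G, ∃ y, cons y s ∈ T) →
    ∃ i, ∀ᶠ s : ℕ → M in G, cons (s i) s ∈ T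

theorem exists_forall_mem_of_isTrans (hpair : ∀ x y : M, ∃ z : M, IsUPair z x y) (a b : M) :
    ∃ c : M, ∀ t : M, IsTrans t → Mem c t → Mem a t ∧ Mem b t := by
  obtain ⟨c, hc⟩ := hpair a b
  exact ⟨c, fun t ht hct => ⟨ht c a hct ((hc a).2 (Or.inl rfl)), ht c b hct ((hc b).2 (Or.inr rfl))⟩⟩

/-- The Rasiowa–Sikorski lemma for large sets of assignments: there is an ultrafilter that contains
enough large sets of `D` and meets countably many requirements of the form "if `A r` is in the
ultrafilter, then so is some member of `B r`". -/
theorem exists_ultrafilter_of_requirements {D : Set (Set (ℕ → M))} {ι : Type*} [Countable ι]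
    (hpair : ∀ x y : M, ∃ z : M, IsUPair z x y) [Nonempty M]
    {S₀ : Set (ℕ → M)} (hS₀ : S₀ ∈ D) (hL₀ : Large S₀)
    (A : ι → Set (ℕ → M)) (B : ι → Set (Set (ℕ → M)))
    (hAB : ∀ r, ∀ S ∈ D, Large (S ∩ A r) → ∃ T ∈ B r, S ∩ T ∈ D ∧ Large (S ∩ T)) :
    ∃ G : Ultrafilter (ℕ → M), (∀ a : M, ∀ᶠ s : ℕ → M in G, IsTrans (s 0) ∧ Mem a (s 0)) ∧
      ∀ r, A r ∈ G → ∃ T ∈ B r, T ∈ G := by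
  have := Encodable.ofCountable ι
  let P := {S : (Set (ℕ → M))ᵒᵈ // OrderDual.ofDual S ∈ D ∧ Large (OrderDual.ofDual S)}
  let st : P → Set (ℕ → M) := fun p => OrderDual.ofDual p.1
  let C : ι → Order.Cofinal P := fun r =>
    { carrier := {p | ¬ Large (st p ∩ A r) ∨ ∃ T ∈ B r, st p ⊆ T}
      isCofinal := fun p => by
        by_cases h : Large (st p ∩ A r)
        · obtain ⟨T, hT, hD, hL⟩ := hAB r _ p.2.1 h
          exact ⟨⟨OrderDual.toDual (st p ∩ T), hD, hL⟩, Or.inr ⟨T, hT, Set.inter_subset_right⟩,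
            fun s hs => hs.1⟩
        · exact ⟨p, Or.inl h, le_rfl⟩ }
  let I := Order.idealOfCofinals (⟨OrderDual.toDual S₀, hS₀, hL₀⟩ : P) C
  let base : I × M → Set (ℕ → M) := fun x => st x.1.1 ∩ {s | IsTrans (s 0) ∧ Mem x.2 (s 0)}
  let F : Filter (ℕ → M) := ⨅ x, Filter.principal (base x)
  have : Nonempty I := ⟨⟨_, Order.mem_idealOfCofinals _ _⟩⟩
  have hF : F.NeBot := by
    refine Filter.iInf_neBot_of_directed' ?_ fun x => ?_
    · rintro ⟨p, a⟩ ⟨p', a'⟩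
      obtain ⟨q, hq, hpq, hpq'⟩ := I.directed p.1 p.2 p'.1 p'.2
      obtain ⟨c, hc⟩ := exists_forall_mem_of_isTrans hpair a a'
      refine ⟨(⟨q, hq⟩, c), Filter.principal_mono.2 fun s hs => ?_,
        Filter.principal_mono.2 fun s hs => ?_⟩
      · exact ⟨hpq hs.1, hs.2.1, (hc _ hs.2.1 hs.2.2).1⟩
      · exact ⟨hpq' hs.1, hs.2.1, (hc _ hs.2.1 hs.2.2).2⟩
    · obtain ⟨s, hs, h⟩ := x.1.1.2.2 x.2
      exact Filter.principal_neBot_iff.2 ⟨s, hs, h⟩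
  let G := Ultrafilter.of F
  have hG : ∀ x, base x ∈ G := fun x =>
    Ultrafilter.of_le F (Filter.mem_iInf_of_mem x (Filter.mem_principal_self _))
  refine ⟨G, fun a => ?_, fun r hr => ?_⟩
  · exact Filter.mem_of_superset (hG (Classical.arbitrary I, a)) Set.inter_subset_right
  · obtain ⟨p, hp, hpI⟩ := Order.cofinal_meets_idealOfCofinals
      (⟨OrderDual.toDual S₀, hS₀, hL₀⟩ : P) C r
    rcases hp with hp | ⟨T, hT, hpT⟩
    · simp only [Large, not_forall] at hp
      obtain ⟨a, ha⟩ := hp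
      obtain ⟨s, hs, hsA⟩ := G.nonempty_of_mem (Filter.inter_mem (hG (⟨p, hpI⟩, a)) hr)
      exact absurd ⟨s, ⟨hs.1, hsA⟩, hs.2⟩ ha
    · exact ⟨T, hT, Filter.mem_of_superset (hG (⟨p, hpI⟩, Classical.arbitrary M))
        (Set.inter_subset_left.trans hpT)⟩

/-- The step that needs collection: a large condition forcing a coordinate into `a ∈ M` has a large
extension that makes this coordinate a fixed element. Otherwise each `x ∈ a` has some `y` that no
transitive set assigned to the variable `0` may contain while the coordinate is `x`; such `y` can be
collected in one set `q`, and no assignment of the condition puts `q` into its transitive set. -/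
theorem IsForcingClass.exists_large_coord_eq {D : Set (Set (ℕ → M))} (hD : IsForcingClass D)
    {S : Set (ℕ → M)} (hS : S ∈ D) (i : ℕ) (a : M) (hL : Large (S ∩ {s | Mem (s i) a})) :
    ∃ b, Large (S ∩ {s | s i = b}) := by
  by_contra! hb
  let T : Set (ℕ → M) := (({s | s ∘ (· + 2) ∈ S} ∩ {s | IsTrans (s 2)}) ∩ {s | Mem (s 1) (s 2)}) ∩
    {s | s (i + 2) = s 0}
  have hT : T ∈ D :=
    hD.inter _ (hD.inter _ (hD.inter _ (hD.reindex _ hS _) _ (hD.coord_trans 2)) _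
      (hD.coord_mem 1 2)) _ (hD.coord_eq _ _)
  have hmem : ∀ x y s, cons x (cons y s) ∈ T ↔ s ∈ S ∧ IsTrans (s 0) ∧ Mem y (s 0) ∧ s i = x :=
    fun x y s => ⟨fun h => ⟨h.1.1.1, h.1.1.2, h.1.2, h.2⟩, fun h => ⟨⟨⟨h.1, h.2.1⟩, h.2.2.1⟩, h.2.2.2⟩⟩
  obtain ⟨q, hq⟩ := hD.coll T hT a fun x _ => by
    have := hb x
    simp only [Large, not_forall] at this
    obtain ⟨y, hy⟩ := this
    refine ⟨y, fun s hs => hy ?_⟩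
    rw [hmem] at hs
    exact ⟨s, ⟨hs.1, hs.2.2.2⟩, hs.2.1, hs.2.2.1⟩
  obtain ⟨s, ⟨hs, hsa⟩, htr, hqs⟩ := hL q
  obtain ⟨y, hyq, hy⟩ := hq _ hsa
  exact hy s ((hmem _ _ _).2 ⟨hs, htr, htr q y hqs hyq, rfl⟩)

/-- A witness of a condition can be named by a coordinate that the condition does not mention. -/
theorem IsForcingClass.exists_large_witness {D : Set (Set (ℕ → M))} (hD : IsForcingClass D)
    {S T : Set (ℕ → M)} (hS : S ∈ D) (hT : T ∈ D) (hL : Large (S ∩ {s | ∃ y, cons y s ∈ T})) :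
    ∃ i, Large (S ∩ {s | cons (s i) s ∈ T}) := by
  obtain ⟨m, hm⟩ := hD.support S hS
  obtain ⟨l, hl⟩ := hD.support T hT
  -- The successor keeps the coordinate `0` fixed.
  let i := max m l + 1
  refine ⟨i, fun a => ?_⟩
  obtain ⟨s, ⟨hs, y, hy⟩, hsa⟩ := hL a
  have hne : ∀ j < max m l + 1, Function.update s i y j = s j := fun j hj =>
    Function.update_of_ne hj.ne _ _
  refine ⟨Function.update s i y, ⟨hm s _ (fun j hj => (hne j (by omega)).symm) hs, ?_⟩, ?_⟩
  · refine hl _ _ (fun j hj => ?_) hy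
    cases j with
    | zero => simp [cons]
    | succ j => exact (hne j (by omega)).symm
  · rwa [hne 0 (by omega)]

theorem IsForcingClass.exists_isGeneric [Countable M] [Nonempty M] {D : Set (Set (ℕ → M))}
    (hD : IsForcingClass D) (hpair : ∀ x y : M, ∃ z : M, IsUPair z x y) (hTCo : ModelsTCo M) :
    ∃ G : Ultrafilter (ℕ → M), IsGeneric D G := by
  have := hD.countable.to_subtype
  have hL₀ : Large {s : ℕ → M | s 0 = s 0} := fun a => by
    obtain ⟨t, ht, hat⟩ := hTCo a
    exact ⟨fun _ => t, rfl, ht, hat⟩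
  obtain ⟨G, hG, hreq⟩ := exists_ultrafilter_of_requirements (ι := (ℕ × M) ⊕ D) hpair
    (hD.coord_eq 0 0) hL₀
    (Sum.elim (fun r => {s | Mem (s r.1) r.2}) fun T => {s | ∃ y, cons y s ∈ T.1})
    (Sum.elim (fun r => Set.range fun b => {s | s r.1 = b})
      fun T => Set.range fun i => {s | cons (s i) s ∈ T.1}) (by
      rintro (⟨i, a⟩ | ⟨T, hT⟩) S hS hL
      · obtain ⟨b, hb⟩ := hD.exists_large_coord_eq hS i a hL
        exact ⟨_, ⟨b, rfl⟩, hD.inter _ hS _ (hD.coord_eq_const i b), hb⟩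
      · obtain ⟨i, hi⟩ := hD.exists_large_witness hS hT hL
        refine ⟨_, ⟨i, rfl⟩, hD.inter _ hS _ ?_, hi⟩
        have : {s : ℕ → M | cons (s i) s ∈ T} =
            {s | s ∘ (fun j => Nat.casesOn j i fun j => j : ℕ → ℕ) ∈ T} := by
          have h : ∀ s : ℕ → M,
              cons (s i) s = s ∘ (fun j => Nat.casesOn j i fun j => j : ℕ → ℕ) := fun s => by
            funext j
            cases j <;> rfl
          simp only [h]
        change {s | cons (s i) s ∈ T} ∈ D
        exact this ▸ hD.reindex T hT _)
  refine ⟨G, hG, fun i a h => ?_, fun T hT h => ?_⟩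
  · obtain ⟨_, ⟨b, rfl⟩, hb⟩ := hreq (Sum.inl (i, a)) h
    exact ⟨b, hb⟩
  · obtain ⟨_, ⟨i, rfl⟩, hi⟩ := hreq (Sum.inr ⟨T, hT⟩) h
    exact ⟨i, hi⟩

end Forcing

/-! ### The structure of coordinates modulo an ultrafilter -/

section GenericModel

variable {M : Type u} (G : Ultrafilter (ℕ → M))

/-- Two coordinates are identified if they agree on a set of the ultrafilter. -/
def coordSetoid : Setoid (ULift.{u} ℕ) where
  r i j := ∀ᶠ s : ℕ → M in G, s i.down = s j.down
  iseqv :=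
    { refl := fun _ => Filter.Eventually.of_forall fun _ => rfl
      symm := fun h => h.mono fun _ => Eq.symm
      trans := fun h h' => (h.and h').mono fun _ h => h.1.trans h.2 }

/-- The coordinate functions `s ↦ s i` on the space of assignments modulo the ultrafilter `G`: a
substructure of the ultrapower of `M` by `G`. -/
def GenericModel : Type u := Quotient (coordSetoid G)

/-- The element of the generic model given by the coordinate `i`. -/
def coord (i : ℕ) : GenericModel G := Quotient.mk (coordSetoid G) ⟨i⟩

/-- A coordinate representing a given element of the generic model. -/
noncomputable def coordRep (x : GenericModel G) : ℕ := (Quotient.out x).down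

variable {G}

theorem coord_coordRep (x : GenericModel G) : coord G (coordRep G x) = x := Quotient.out_eq x

theorem coord_eq_coord {i j : ℕ} : coord G i = coord G j ↔ ∀ᶠ s : ℕ → M in G, s i = s j :=
  Quotient.eq

variable [LSet.Structure M]

noncomputable instance : LSet.Structure (GenericModel G) where
  funMap f := isEmptyElim f
  RelMap R xs := ∀ᶠ s : ℕ → M in G, Structure.RelMap R fun i => s (coordRep G (xs i))

theorem relMap_coord {n : ℕ} (R : LSet.Relations n) (d : Fin n → ℕ) :
    Structure.RelMap R (fun i => coord G (d i)) ↔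
      ∀ᶠ s : ℕ → M in G, Structure.RelMap R fun i => s (d i) := by
  have h : ∀ᶠ s : ℕ → M in G, ∀ i, s (coordRep G (coord G (d i))) = s (d i) :=
    Filter.eventually_all.2 fun i => coord_eq_coord.1 (coord_coordRep _)
  refine Filter.eventually_congr (h.mono fun s hs => ?_)
  simp only [hs]

theorem mem_coord {i j : ℕ} :
    Mem (coord G i) (coord G j) ↔ ∀ᶠ s : ℕ → M in G, Mem (s i) (s j) := by
  have := relMap_coord (G := G) memSym ![i, j]
  have e : ∀ {X : Type u} (f : ℕ → X), (fun k => f (![i, j] k)) = ![f i, f j] := fun f => by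
    funext k
    fin_cases k <;> rfl
  simpa only [e, Mem] using this

variable {α : Type} {n : ℕ}

/-- The truth lemma for `φ`: it holds of coordinates in the generic model if and only if it holds
of their values almost everywhere. -/
def Truth (G : Ultrafilter (ℕ → M)) (φ : LSet.BoundedFormula α n) : Prop :=
  ∀ (v : α → ℕ) (xs : Fin n → ℕ), φ.Realize (coord G ∘ v) (coord G ∘ xs) ↔
    ∀ᶠ s : ℕ → M in G, φ.Realize (s ∘ v) (s ∘ xs)

/-- If there is almost everywhere a witness for the last variable of `φ`, then some coordinate is
almost everywhere a witness. -/
def Witnessed (G : Ultrafilter (ℕ → M)) (φ : LSet.BoundedFormula α (n + 1)) : Prop :=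
  ∀ (v : α → ℕ) (xs : Fin n → ℕ),
    (∀ᶠ s : ℕ → M in G, ∃ y, φ.Realize (s ∘ v) (Fin.snoc (s ∘ xs) y : Fin (n + 1) → M)) →
      ∃ i, ∀ᶠ s : ℕ → M in G, φ.Realize (s ∘ v) (Fin.snoc (s ∘ xs) (s i) : Fin (n + 1) → M)

theorem Truth.falsum : Truth G (⊥ : LSet.BoundedFormula α n) := fun _ _ => by
  simp only [BoundedFormula.realize_bot, Filter.eventually_false_iff_eq_bot]
  exact (iff_false_intro G.neBot.ne).symm

theorem term_eq_var (t : LSet.Term (α ⊕ Fin n)) :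
    ∃ c : α ⊕ Fin n, t = Term.var c := by
  cases t with
  | var c => exact ⟨c, rfl⟩
  | func f _ => exact isEmptyElim f

theorem Truth.atomic {φ : LSet.BoundedFormula α n} (h : φ.IsAtomic) : Truth G φ := by
  intro v xs
  have e : ∀ {X : Type u} (f : ℕ → X) (c : α ⊕ Fin n),
      Sum.elim (f ∘ v) (f ∘ xs) c = f (Sum.elim v xs c) := fun f c => by cases c <;> rfl
  cases h with
  | equal t₁ t₂ =>
    obtain ⟨c₁, rfl⟩ := term_eq_var t₁
    obtain ⟨c₂, rfl⟩ := term_eq_var t₂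
    simp only [BoundedFormula.realize_bdEqual, Term.realize_var, e, coord_eq_coord]
  | rel R ts =>
    choose c hc using fun i => term_eq_var (ts i)
    simp only [BoundedFormula.realize_rel, hc, Term.realize_var, e, relMap_coord]

theorem Truth.imp {φ ψ : LSet.BoundedFormula α n} (hφ : Truth G φ) (hψ : Truth G ψ) :
    Truth G (φ.imp ψ) := fun v xs => by
  simp only [BoundedFormula.realize_imp, hφ v xs, hψ v xs, Ultrafilter.eventually_imp]

theorem Truth.snoc {φ : LSet.BoundedFormula α (n + 1)} (hφ : Truth G φ) (v : α → ℕ)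
    (xs : Fin n → ℕ) (i : ℕ) :
    φ.Realize (coord G ∘ v) (Fin.snoc (coord G ∘ xs) (coord G i) : Fin (n + 1) → _) ↔
      ∀ᶠ s : ℕ → M in G, φ.Realize (s ∘ v) (Fin.snoc (s ∘ xs) (s i) : Fin (n + 1) → M) := by
  have := hφ v (Fin.snoc xs i : Fin (n + 1) → ℕ)
  simpa only [Fin.comp_snoc] using this

theorem Truth.ex {φ : LSet.BoundedFormula α (n + 1)} (hφ : Truth G φ) (hw : Witnessed G φ) :
    Truth G φ.ex := fun v xs => by
  simp only [BoundedFormula.realize_ex]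
  constructor
  · rintro ⟨x, hx⟩
    rw [← coord_coordRep x, hφ.snoc] at hx
    exact hx.mono fun s hs => ⟨_, hs⟩
  · intro h
    obtain ⟨i, hi⟩ := hw v xs h
    exact ⟨coord G i, (hφ.snoc v xs i).2 hi⟩

theorem Truth.all {φ : LSet.BoundedFormula α (n + 1)} (hφ : Truth G φ)
    (hw : Witnessed G φ.not) : Truth G φ.all := by
  have h := (Truth.ex (hφ.imp Truth.falsum) hw).imp Truth.falsum
  intro v xs
  have := h v xs
  simp only [BoundedFormula.realize_imp, BoundedFormula.realize_ex, BoundedFormula.realize_bot,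
    imp_false] at this
  simpa only [BoundedFormula.realize_all, not_exists, not_not] using this

theorem Witnessed.congr {φ ψ : LSet.BoundedFormula α (n + 1)} (h : Witnessed G φ)
    (e : ∀ (v : α → M) (xs : Fin (n + 1) → M), φ.Realize v xs ↔ ψ.Realize v xs) :
    Witnessed G ψ := by
  simpa only [Witnessed, e] using h

end GenericModel

/-! ### Forcing classes given by classes of formulas -/

section FormulaClass

theorem exists_forall_lt {M : Type u} {k : ℕ} (g : Fin k → M ⊕ ℕ) :
    ∃ m : ℕ, ∀ j c, g j = Sum.inr c → c < m := by
  refine ⟨∑ j, Sum.elim (fun _ => 0) id (g j) + 1, fun j c h => Nat.lt_succ_of_le ?_⟩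
  have := Finset.single_le_sum (f := fun j => Sum.elim (fun _ => 0) id (g j))
    (fun _ _ => Nat.zero_le _) (Finset.mem_univ j)
  simpa [h] using this

variable (M : Type u) [LSet.Structure M]

/-- A class of formulas that is rich enough for its definable sets to be used as forcing
conditions over `M`. The last field is collection for the universal closure of the negation of `φ`
in all but two variables. -/
structure IsFormulaClass (C : ∀ ⦃α : Type⦄ ⦃n : ℕ⦄, LSet.BoundedFormula α n → Prop) : Prop where
  delta0 : ∀ {α : Type} {n : ℕ} {φ : LSet.BoundedFormula α n}, IsDelta0 φ → C φ
  rename : ∀ {α β : Type} {n m : ℕ} {φ : LSet.BoundedFormula α n}, C φ →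
    ∀ g : α ⊕ Fin n → β ⊕ Fin m, C (rename g φ)
  inf : ∀ {α : Type} {n : ℕ} {φ ψ : LSet.BoundedFormula α n}, C φ → C ψ →
    ∃ χ : LSet.BoundedFormula α n, C χ ∧
      ∀ (v : α → M) (xs : Fin n → M), χ.Realize v xs ↔ φ.Realize v xs ∧ ψ.Realize v xs
  coll : ∀ {k m : ℕ} {φ : LSet.BoundedFormula (Fin k ⊕ Fin 2) m}, C φ →
    ∃ χ : LSet.BoundedFormula (Fin k) 2, SatColl M χ ∧
      ∀ (v : Fin k → M) (xs : Fin 2 → M), χ.Realize v xs ↔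
        ∀ zs : Fin m → M, ¬ φ.Realize (Sum.elim v xs) zs

variable {M} {C : ∀ ⦃α : Type⦄ ⦃n : ℕ⦄, LSet.BoundedFormula α n → Prop}

/-- The sets of assignments `s` defined by formulas of the class `C`, with parameters in `M` and
finitely many of the values `s i` substituted for the variables. -/
def definableSets (M : Type u) [LSet.Structure M]
    (C : ∀ ⦃α : Type⦄ ⦃n : ℕ⦄, LSet.BoundedFormula α n → Prop) : Set (Set (ℕ → M)) :=
  {S | ∃ (k : ℕ) (φ : LSet.Formula (Fin k)) (g : Fin k → M ⊕ ℕ),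
    C φ ∧ S = {s | φ.Realize (Sum.elim id s ∘ g)}}

theorem countable_definableSets [Countable M] : (definableSets M C).Countable := by
  have : Countable LSet.Symbols := by
    have : Countable (Σ l, LSet.Functions l) :=
      inferInstanceAs (Countable (Σ _ : ℕ, Empty))
    have : ∀ l, Countable (LSet.Relations l) := fun l =>
      Function.Injective.countable (f := fun _ : LSet.Relations l => ())
        fun a b _ => by cases a; cases b; rfl
    have : Countable (Σ l, LSet.Relations l) := inferInstance
    exact inferInstanceAs (Countable ((Σ l, LSet.Functions l) ⊕ (Σ l, LSet.Relations l)))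
  refine (Set.countable_range fun x : Σ k : ℕ, LSet.Formula (Fin k) × (Fin k → M ⊕ ℕ) =>
    {s : ℕ → M | x.2.1.Realize (Sum.elim id s ∘ x.2.2)}).mono ?_
  rintro _ ⟨k, φ, g, -, rfl⟩
  exact ⟨⟨k, φ, g⟩, rfl⟩

namespace IsFormulaClass

variable (hC : IsFormulaClass M C)
include hC

theorem mem_definableSets {k n : ℕ} {φ : LSet.BoundedFormula (Fin k) n} (h : C φ)
    (g : Fin k → M ⊕ ℕ) (f : Fin n → M ⊕ ℕ) :
    {s : ℕ → M | φ.Realize (Sum.elim id s ∘ g) (Sum.elim id s ∘ f)} ∈ definableSets M C := by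
  refine ⟨k + n, LevySet.rename (Sum.inl ∘ finSumFinEquiv) φ, Fin.append g f, hC.rename h _, ?_⟩
  ext s
  have h₁ : Fin.append g f ∘ finSumFinEquiv ∘ Sum.inl = g := by funext; simp
  have h₂ : Fin.append g f ∘ finSumFinEquiv ∘ Sum.inr = f := by funext; simp
  have h₃ : ∀ (x : Fin (k + n) → M) (y : Fin 0 → M), Sum.elim x y ∘ Sum.inl = x := fun _ _ => rfl
  simp only [Set.mem_ofPred_eq, Formula.Realize, realize_rename, Function.comp_assoc]
  simp only [← Function.comp_assoc, h₃]
  simp only [Function.comp_assoc, h₁, h₂]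

/-- Collection for a definable set: the coordinates from `2` on become quantified variables. -/
theorem coll_definableSets {S : Set (ℕ → M)} (hS : S ∈ definableSets M C) (a : M)
    (h : ∀ x, Mem x a → ∃ y, ∀ s, cons x (cons y s) ∉ S) :
    ∃ q, ∀ x, Mem x a → ∃ y, Mem y q ∧ ∀ s, cons x (cons y s) ∉ S := by
  obtain ⟨k, φ, g, hφ, rfl⟩ := hS
  obtain ⟨m, hm⟩ := exists_forall_lt g
  let var : Fin k → ℕ → (Fin k ⊕ Fin 2) ⊕ Fin m := fun j c =>
    match c with
    | 0 => Sum.inl (Sum.inr 0)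
    | 1 => Sum.inl (Sum.inr 1)
    -- The bound `m` excludes the second case of the distinction.
    | c + 2 => if h : c < m then Sum.inr ⟨c, h⟩ else Sum.inl (Sum.inl j)
  let ρ : Fin k ⊕ Fin 0 → (Fin k ⊕ Fin 2) ⊕ Fin m :=
    Sum.elim (fun j => Sum.elim (fun _ => Sum.inl (Sum.inl j)) (var j) (g j)) Fin.elim0
  let p : Fin k → M := fun j => Sum.elim id (fun _ => a) (g j)
  have key : ∀ x y s, cons x (cons y s) ∈ {s | φ.Realize (Sum.elim id s ∘ g)} ↔
      (LevySet.rename ρ φ).Realize (Sum.elim p ![x, y]) (s ∘ Fin.val) := by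
    intro x y s
    have e : Sum.elim id (cons x (cons y s)) ∘ g =
        Sum.elim (Sum.elim p ![x, y]) (s ∘ Fin.val) ∘ ρ ∘ Sum.inl := by
      funext j
      have hj := hm j
      rcases hg : g j with b | c
      · simp [ρ, p, hg]
      · have hc := hj c hg
        match c, hc with
        | 0, _ => simp [ρ, hg, var, cons]
        | 1, _ => simp [ρ, hg, var, cons]
        | c + 2, hc =>
          have : c < m := by omega
          simp [ρ, hg, var, cons, this]
    rw [realize_rename, Set.mem_ofPred_eq, Formula.Realize, e]
    exact iff_of_eq (congrArg _ (Subsingleton.elim _ _))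
  obtain ⟨χ, hcoll, hχ⟩ := hC.coll (hC.rename hφ ρ)
  have key' : ∀ x y, χ.Realize p ![x, y] ↔
      ∀ s, cons x (cons y s) ∉ {s | φ.Realize (Sum.elim id s ∘ g)} := by
    intro x y
    simp only [key, hχ]
    refine ⟨fun h s => h _, fun h zs => ?_⟩
    have hzs : (fun i => if h : i < m then zs ⟨i, h⟩ else a) ∘ Fin.val = zs := by
      funext i
      simp
    exact hzs ▸ h fun i => if h : i < m then zs ⟨i, h⟩ else a
  simp only [← key'] at h ⊢
  exact hcoll p a h

theorem isForcingClass [Countable M] : IsForcingClass (definableSets M C) where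
  countable := countable_definableSets
  inter := by
    rintro _ ⟨k, φ, g, hφ, rfl⟩ _ ⟨l, ψ, f, hψ, rfl⟩
    obtain ⟨χ, hχ, h⟩ := hC.inf (hC.rename hφ (Sum.map (Fin.castAdd l) id))
      (hC.rename hψ (Sum.map (Fin.natAdd k) id))
    refine ⟨k + l, χ, Fin.append g f, hχ, ?_⟩
    ext s
    have h₁ : Fin.append g f ∘ Fin.castAdd l = g := by funext; simp
    have h₂ : Fin.append g f ∘ Fin.natAdd k = f := by funext; simp
    simp only [Set.mem_inter_iff, Set.mem_ofPred_eq, Formula.Realize, h, realize_rename]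
    refine and_congr (iff_of_eq ?_) (iff_of_eq ?_)
    · congr 1
      · nth_rw 1 [← h₁]
        rfl
    · congr 1
      · nth_rw 1 [← h₂]
        rfl
  reindex := by
    rintro _ ⟨k, φ, g, hφ, rfl⟩ f
    refine ⟨k, φ, Sum.map id f ∘ g, hφ, ?_⟩
    ext s
    have : Sum.elim id (s ∘ f) ∘ g = Sum.elim id s ∘ Sum.map id f ∘ g := by
      funext j
      simp only [Function.comp_apply]
      cases g j <;> rfl
    simp [this]
  coord_eq i j := by
    have := hC.mem_definableSets (k := 0)
      (φ := (Term.var (Sum.inr 0)).bdEqual (Term.var (Sum.inr 1)))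
      (hC.delta0 (.atomic (.equal _ _))) Fin.elim0 ![Sum.inr i, Sum.inr j]
    simpa using this
  coord_eq_const i b := by
    have := hC.mem_definableSets (k := 0)
      (φ := (Term.var (Sum.inr 0)).bdEqual (Term.var (Sum.inr 1)))
      (hC.delta0 (.atomic (.equal _ _))) Fin.elim0 ![Sum.inr i, Sum.inl b]
    simpa using this
  coord_mem i j := by
    have := hC.mem_definableSets (k := 0) (φ := memFormula (Sum.inr 0) (Sum.inr 1))
      (hC.delta0 (isDelta0_memFormula _ _)) Fin.elim0 ![Sum.inr i, Sum.inr j]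
    simpa [realize_memFormula] using this
  coord_trans i := by
    have := hC.mem_definableSets (n := 0)
      (φ := ((lastMem (Sum.inl (0 : Fin 1))).imp
        ((lastMem (Sum.inr 0)).imp (memFormula (Sum.inr 1) (Sum.inl 0))).all).all)
      (hC.delta0 (.ball _ (.ball _ (isDelta0_memFormula _ _)))) ![Sum.inr i] Fin.elim0
    have e : ∀ s : ℕ → M,
        IsTrans (s i) ↔ ∀ x, Mem x (s i) → ∀ y, Mem y x → Mem y (s i) := fun s =>
      ⟨fun h x hx y hy => h x y hx hy, fun h x y hx hy => h x hx y hy⟩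
    simpa [realize_memFormula, realize_lastMem, e, Fin.snoc] using this
  support := by
    rintro _ ⟨k, φ, g, -, rfl⟩
    obtain ⟨m, hm⟩ := exists_forall_lt g
    refine ⟨m, fun s s' hs h => ?_⟩
    have : Sum.elim id s ∘ g = Sum.elim id s' ∘ g := by
      funext j
      rcases hg : g j with b | c
      · simp [hg]
      · simp [hg, hs c (hm j c hg)]
    simpa [this] using h
  coll _ hS := hC.coll_definableSets hS

theorem witnessed {G : Ultrafilter (ℕ → M)} (hG : IsGeneric (definableSets M C) G) {k n : ℕ}
    {φ : LSet.BoundedFormula (Fin k) (n + 1)} (h : C φ) : Witnessed G φ := by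
  intro v xs hy
  have hT := hC.mem_definableSets h (fun j => Sum.inr (v j + 1))
    (Fin.snoc (fun j => Sum.inr (xs j + 1)) (Sum.inr 0))
  have e : ∀ y s, cons y s ∈ {s : ℕ → M | φ.Realize (Sum.elim id s ∘ fun j => Sum.inr (v j + 1))
      (Sum.elim id s ∘ Fin.snoc (fun j => Sum.inr (xs j + 1)) (Sum.inr 0))} ↔
      φ.Realize (s ∘ v) (Fin.snoc (s ∘ xs) y : Fin (n + 1) → M) := by
    intro y s
    rw [Set.mem_ofPred_eq, Fin.comp_snoc]
    rfl
  have := hG.witness _ hT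
  simp only [e] at this
  exact this hy

theorem truth_of_isDelta0 {G : Ultrafilter (ℕ → M)} (hG : IsGeneric (definableSets M C) G)
    {k n : ℕ} {φ : LSet.BoundedFormula (Fin k) n} (h : IsDelta0 φ) : Truth G φ := by
  induction h with
  | falsum => exact .falsum
  | atomic h => exact .atomic h
  | imp _ _ ih₁ ih₂ => exact ih₁.imp ih₂
  | ball b h ih =>
    have hb := isDelta0_memFormula (Sum.inr (Fin.last _)) (Sum.map id Fin.castSucc b)
    exact Truth.all ((Truth.atomic (.rel _ _)).imp ih) (hC.witnessed hG (hC.delta0 (hb.imp h).not))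
  | bex b h ih =>
    have hb := isDelta0_memFormula (Sum.inr (Fin.last _)) (Sum.map id Fin.castSucc b)
    exact Truth.ex (((Truth.atomic (.rel _ _)).imp (ih.imp .falsum)).imp .falsum)
      (hC.witnessed hG (hC.delta0 (hb.inf h)))

end IsFormulaClass

theorem isFormulaClass_sigma [Nonempty M] {n : ℕ} (hM : ModelsCollSigma M (n + 2)) :
    IsFormulaClass M fun _ _ φ => IsSigma (n + 1) φ where
  delta0 h := (IsLevy.delta0 h).mono (Nat.zero_le _)
  rename h g := h.rename g
  inf h h' := h.exists_inf h'
  coll {k m φ} h := by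
    obtain ⟨ψ, hψ, e⟩ := h.exists_not (M := M)
    refine ⟨rename (Sum.elim id Fin.elim0) ψ.alls, hM _ _ (.of_pi (hψ.alls.rename _)),
      fun v xs => ?_⟩
    have := BoundedFormula.realize_alls (φ := ψ) (v := Sum.elim v xs)
    simp only [e] at this
    rw [← this, realize_rename, Formula.Realize]
    exact iff_of_eq (congrArg _ (Subsingleton.elim _ _))

theorem isFormulaClass_univ (hM : ModelsColl M) : IsFormulaClass M fun _ _ _ => True where
  delta0 _ := trivial
  rename _ _ := trivial
  inf {_ _ φ ψ} _ _ := ⟨φ ⊓ ψ, trivial, fun _ _ => BoundedFormula.realize_inf⟩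
  coll {k m φ} _ := by
    refine ⟨rename (Sum.elim id Fin.elim0) φ.not.alls, hM _ _, fun v xs => ?_⟩
    have := BoundedFormula.realize_alls (φ := φ.not) (v := Sum.elim v xs)
    simp only [BoundedFormula.realize_not] at this
    rw [← this, realize_rename, Formula.Realize]
    exact iff_of_eq (congrArg _ (Subsingleton.elim _ _))

end FormulaClass

/-! ### The generic end extension -/

section Extension

variable {M : Type u} [LSet.Structure M] {C : ∀ ⦃α : Type⦄ ⦃n : ℕ⦄, LSet.BoundedFormula α n → Prop}
  {G : Ultrafilter (ℕ → M)}

theorem IsGeneric.exists_coord_eq {D : Set (Set (ℕ → M))} (hG : IsGeneric D G)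
    (hD : IsForcingClass D) (a : M) : ∃ i, ∀ᶠ s : ℕ → M in G, s i = a :=
  hG.witness _ (hD.coord_eq_const 0 a) (.of_forall fun _ => ⟨a, rfl⟩)

section Naming

-- `nm a` is a coordinate that is almost everywhere equal to `a`.
variable {nm : M → ℕ} (hnm : ∀ a, ∀ᶠ s : ℕ → M in G, s (nm a) = a)
include hnm

theorem eventually_realize_comp {k n : ℕ} (φ : LSet.BoundedFormula (Fin k) n) (v : Fin k → M)
    (xs : Fin n → M) :
    (∀ᶠ s : ℕ → M in G, φ.Realize (s ∘ nm ∘ v) (s ∘ nm ∘ xs)) ↔ φ.Realize v xs := by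
  have hv : ∀ᶠ s : ℕ → M in G, s ∘ nm ∘ v = v :=
    (Filter.eventually_all.2 fun i => hnm (v i)).mono fun s hs => funext hs
  have hxs : ∀ᶠ s : ℕ → M in G, s ∘ nm ∘ xs = xs :=
    (Filter.eventually_all.2 fun i => hnm (xs i)).mono fun s hs => funext hs
  rw [Filter.eventually_congr ((hv.and hxs).mono fun s hs => by rw [hs.1, hs.2]),
    Filter.eventually_const]

theorem Truth.realize_iff {k n : ℕ} {φ : LSet.BoundedFormula (Fin k) n} (h : Truth G φ)
    (v : Fin k → M) (xs : Fin n → M) :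
    φ.Realize (coord G ∘ nm ∘ v) (coord G ∘ nm ∘ xs) ↔ φ.Realize v xs :=
  (h _ _).trans (eventually_realize_comp hnm φ v xs)

/-- The embedding of `M` into the generic model that sends `a` to the coordinate naming it. -/
noncomputable def nameEmbedding : M ↪[LSet] GenericModel G where
  toFun a := coord G (nm a)
  inj' a b h := by
    obtain ⟨s, hs, ha, hb⟩ := ((coord_eq_coord.1 h).and ((hnm a).and (hnm b))).exists
    rw [← ha, hs, hb]
  map_fun' f := isEmptyElim f
  map_rel' {n} R xs := by
    have := Truth.realize_iff hnm
      (Truth.atomic (G := G) (.rel R fun i => Term.var (Sum.inr i))) (n := n) (Fin.elim0 : _ → M) xs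
    simpa [BoundedFormula.realize_rel, Function.comp_def] using this

theorem IsGeneric.isEndExtension {D : Set (Set (ℕ → M))} (hG : IsGeneric D G) :
    IsEndExtension fun a => coord G (nm a) := by
  intro a x hx
  rw [← coord_coordRep x, mem_coord] at hx
  obtain ⟨b, hb⟩ := hG.bounded (coordRep G x) a ((hx.and (hnm a)).mono fun s hs => hs.2 ▸ hs.1)
  refine ⟨b, ?_⟩
  rw [← coord_coordRep x, coord_eq_coord]
  exact ((hnm b).and hb).mono fun s hs => hs.1.trans hs.2.symm

theorem IsGeneric.isTallerStar {D : Set (Set (ℕ → M))} (hG : IsGeneric D G) :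
    IsTallerStar fun a => coord G (nm a) := by
  refine ⟨coord G 0, fun x y hx hy => ?_, fun a => ?_⟩
  · rw [← coord_coordRep x] at hx hy
    rw [← coord_coordRep y] at hy ⊢
    rw [mem_coord] at hx hy ⊢
    obtain ⟨a⟩ : Nonempty M := (G.neBot.nonempty).map fun s => s 0
    exact ((hG.tall a).and (hx.and hy)).mono fun s hs => hs.1.1 _ _ hs.2.1 hs.2.2
  · exact mem_coord.2 (((hG.tall a).and (hnm a)).mono fun s hs => hs.2.symm ▸ hs.1.2)

end Naming

theorem truth_of_isLevy {n : ℕ} (hC : IsFormulaClass M fun _ _ φ => IsSigma (n + 1) φ)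
    (hG : IsGeneric (definableSets M fun _ _ φ => IsSigma (n + 1) φ) G) {b : Bool} {k l m : ℕ}
    {φ : LSet.BoundedFormula (Fin l) m} (h : IsLevy b k φ) (hk : k ≤ n + 1) : Truth G φ := by
  induction h with
  | delta0 h => exact hC.truth_of_isDelta0 hG h
  | of_pi _ ih => exact ih (by omega)
  | of_sigma _ ih => exact ih (by omega)
  | ex h ih => exact (ih hk).ex (hC.witnessed hG (h.mono hk))
  | all h ih =>
    obtain ⟨χ, hχ, e⟩ := h.exists_not (M := M)
    exact (ih hk).all ((hC.witnessed hG (hχ.mono hk)).congr e)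

theorem truth_of_univ (hC : IsFormulaClass M fun _ _ _ => True)
    (hG : IsGeneric (definableSets M fun _ _ _ => True) G) {l m : ℕ}
    (φ : LSet.BoundedFormula (Fin l) m) : Truth G φ := by
  induction φ with
  | falsum => exact .falsum
  | equal => exact .atomic (.equal _ _)
  | rel => exact .atomic (.rel _ _)
  | imp _ _ ih₁ ih₂ => exact ih₁.imp ih₂
  | all _ ih => exact ih.all (hC.witnessed hG trivial)

/-- `Σ_{k+1}` formulas true in the generic model are true of the values of the coordinates, if the
truth lemma holds for `Π_k` formulas. -/
theorem IsLevy.eventually_realize {k : ℕ}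
    (hT : ∀ {l m : ℕ} {φ : LSet.BoundedFormula (Fin l) m}, IsPi k φ → Truth G φ) {l m : ℕ}
    {φ : LSet.BoundedFormula (Fin l) m} (h : IsLevy true (k + 1) φ) (v : Fin l → ℕ) (xs : Fin m → ℕ)
    (hφ : φ.Realize (coord G ∘ v) (coord G ∘ xs)) :
    ∀ᶠ s : ℕ → M in G, φ.Realize (s ∘ v) (s ∘ xs) := by
  generalize hb : true = b at h
  generalize hk : k + 1 = k' at h
  induction h with
  | delta0 => cases hk
  | of_sigma => cases hb
  | all => cases hb
  | of_pi h => cases hk; exact (hT h v xs).1 hφ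
  | ex h ih =>
    obtain ⟨x, hx⟩ := BoundedFormula.realize_ex.1 hφ
    rw [← coord_coordRep x, ← Fin.comp_snoc] at hx
    refine (ih _ hx hb hk).mono fun s hs => BoundedFormula.realize_ex.2 ⟨s (coordRep G x), ?_⟩
    rwa [Fin.comp_snoc] at hs

/-- `Σ_{k+1}` formulas true in `M` stay true in the generic model, if the truth lemma holds for
`Π_k` formulas. -/
theorem IsLevy.realize_coord {nm : M → ℕ} (hnm : ∀ a, ∀ᶠ s : ℕ → M in G, s (nm a) = a) {k : ℕ}
    (hT : ∀ {l m : ℕ} {φ : LSet.BoundedFormula (Fin l) m}, IsPi k φ → Truth G φ) {l m : ℕ}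
    {φ : LSet.BoundedFormula (Fin l) m} (h : IsLevy true (k + 1) φ) (v : Fin l → M) (xs : Fin m → M)
    (hφ : φ.Realize v xs) : φ.Realize (coord G ∘ nm ∘ v) (coord G ∘ nm ∘ xs) := by
  generalize hb : true = b at h
  generalize hk : k + 1 = k' at h
  induction h with
  | delta0 => cases hk
  | of_sigma => cases hb
  | all => cases hb
  | of_pi h => cases hk; exact ((hT h).realize_iff hnm v xs).2 hφ
  | ex h ih =>
    obtain ⟨a, ha⟩ := BoundedFormula.realize_ex.1 hφ
    have := ih _ ha hb hk
    rw [Fin.comp_snoc, Fin.comp_snoc] at this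
    exact BoundedFormula.realize_ex.2 ⟨_, this⟩

end Extension

end LevySet

theorem mainTheorem7 {M : Type u} [LevySet.LSet.Structure M] [Countable M]
    (hDB : LevySet.ModelsDB0 M) (hTCo : LevySet.ModelsTCo M) :
    (∀ n : ℕ, LevySet.ModelsCollSigma M (n + 2) →
      ∃ (N : Type u) (_ : LevySet.LSet.Structure N) (j : M ↪[LevySet.LSet] N),
        LevySet.IsSigmaElementary (n + 2) j ∧ LevySet.IsEndExtension j ∧
          LevySet.IsTallerStar j) ∧
    (LevySet.ModelsColl M →
      ∃ (N : Type u) (_ : LevySet.LSet.Structure N) (j : M ↪ₑ[LevySet.LSet] N),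
        LevySet.IsEndExtension j ∧ LevySet.IsTallerStar j) := by
  open LevySet in
  have : Nonempty M := hDB.nullset.nonempty
  refine ⟨fun n hColl => ?_, fun hColl => ?_⟩
  · have hC := isFormulaClass_sigma hColl
    obtain ⟨G, hG⟩ := hC.isForcingClass.exists_isGeneric hDB.pairing hTCo
    choose nm hnm using hG.exists_coord_eq hC.isForcingClass
    have hT : ∀ {l m : ℕ} {φ : LSet.BoundedFormula (Fin l) m}, IsPi (n + 1) φ → Truth G φ :=
      fun h => truth_of_isLevy hC hG h le_rfl
    refine ⟨GenericModel G, inferInstance, nameEmbedding hnm, fun k φ hφ a => ?_,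
      hG.isEndExtension hnm, hG.isTallerStar hnm⟩
    have e : (coord G ∘ nm ∘ (default : Fin 0 → M)) = default := Subsingleton.elim _ _
    refine ⟨fun h => (eventually_realize_comp hnm φ a default).1 ?_, fun h => ?_⟩
    · refine hφ.eventually_realize hT _ _ ?_
      rw [e]
      exact h
    · have := hφ.realize_coord hnm hT a default h
      rw [e] at this
      exact this
  · have hC := isFormulaClass_univ hColl
    obtain ⟨G, hG⟩ := hC.isForcingClass.exists_isGeneric hDB.pairing hTCo
    choose nm hnm using hG.exists_coord_eq hC.isForcingClass
    refine ⟨GenericModel G, inferInstance, ⟨fun a => coord G (nm a), fun k φ a => ?_⟩,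
      hG.isEndExtension hnm, hG.isTallerStar hnm⟩
    have := (truth_of_univ hC hG φ).realize_iff hnm a default
    rwa [Subsingleton.elim (coord G ∘ nm ∘ (default : Fin 0 → M)) default] at this
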